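/- An $L$-algebra is a set $X$ with a binary operation $\cdot$ and an element $1$ such that $x\cdot x=x\cdot 1=1$, $1\cdot x=x$, $(x\cdot y)\cdot(x\cdot z)=(y\cdot x)\cdot(y\cdot z)$, and $x\cdot y=y\cdot x=1$ implies $x=y$; it is partially ordered by $x\le y:\Leftrightarrow x\cdot y=1$. It is self-similar if for every $y$ the map $z\mapsto y\cdot z$ is a bijection from $\{z : z\le y\}$ onto $X$; then $X$ is a monoid, where $xy$ is the unique $z\le y$ with $y\cdot z=x$. The self-similar closure $S(X)$ of an $L$-algebra $X$ is the universal self-similar $L$-algebra over $X$; it contains $X$ as an $L$-subalgebra and is generated by $X$ as a monoid, and up to isomorphism over $X$ it is the only self-similar $L$-algebra with these two properties. Let $X$ and $Y$ be $L$-algebras, and let $X\times Y$ and $S(X)\times S(Y)$ carry the component-wise operations. Then $S(X\times Y)=S(X)\times S(Y)$: the $L$-algebra $S(X)\times S(Y)$ is self-similar, contains $X\times Y$ as an $L$-subalgebra, and is generated by $X\times Y$ as a monoid; and there is a unique morphism of $L$-algebras $S(X\times Y)\to S(X)\times S(Y)$ that extends the inclusion of $X\times Y$, and it is an isomorphism.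 In particular, identify $x\in X$ with $(x,1)$ and $y\in Y$ with $(1,y)$ in $X\times Y\subset S(X\times Y)$. Then $$xy=yx=x\wedge y=(x,y)$$ holds in $S(X\times Y)$ for all $x\in X$ and $y\in Y$, and each element of $X\times Y$ has a unique representation in this form with $x\in X$ and $y\in Y$. -/

import Mathlib

universe u v

/-- An `L`-algebra: a set with a binary operation `x ⊸ y` and a logical unit `1`. -/
class LAlgebra (X : Type u) extends One X where
  /-- the operation `x · y` (implication) -/
  imp : X → X → X
  imp_self : ∀ x : X, imp x x = 1
  imp_one : ∀ x : X, imp x 1 = 1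
  one_imp : ∀ x : X, imp 1 x = x
  imp_imp_imp : ∀ x y z : X, imp (imp x y) (imp x z) = imp (imp y x) (imp y z)
  imp_antisymm : ∀ x y : X, imp x y = 1 → imp y x = 1 → x = y

namespace LAlgebra

infixr:60 " ⊸ " => LAlgebra.imp

/-- The partial order of an `L`-algebra: `x ≤ y` iff `x · y = 1`. -/
def Le {X : Type u} [LAlgebra X] (x y : X) : Prop := x ⊸ y = 1

infix:50 " ≼ " => LAlgebra.Le

/-- A morphism of `L`-algebras. -/
def IsMorphism {X : Type u} {Y : Type v} [LAlgebra X] [LAlgebra Y] (f : X → Y) : Prop :=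
  ∀ x y : X, f (x ⊸ y) = f x ⊸ f y

/-- The cartesian product of two `L`-algebras, with component-wise operation. -/
instance instProd {X : Type u} {Y : Type v} [LAlgebra X] [LAlgebra Y] : LAlgebra (X × Y) where
  imp p q := (p.1 ⊸ q.1, p.2 ⊸ q.2)
  imp_self _ := Prod.ext (imp_self _) (imp_self _)
  imp_one _ := Prod.ext (imp_one _) (imp_one _)
  one_imp _ := Prod.ext (one_imp _) (one_imp _)
  imp_imp_imp _ _ _ := Prod.ext (imp_imp_imp _ _ _) (imp_imp_imp _ _ _)
  imp_antisymm _ _ h h' :=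
    Prod.ext (imp_antisymm _ _ (congrArg Prod.fst h) (congrArg Prod.fst h'))
      (imp_antisymm _ _ (congrArg Prod.snd h) (congrArg Prod.snd h'))

/-- `X` is self-similar: for every `y` the map `z ↦ y · z` is a bijection from the downset of `y`
onto `X`. -/
def IsSelfSimilar (X : Type u) [LAlgebra X] : Prop :=
  ∀ y : X, Set.BijOn (fun z => y ⊸ z) {z | z ≼ y} Set.univ

/-- The (in general partial) multiplication of an `L`-algebra: `IsProd x y z` says that the product
`x y` exists and equals `z`, i.e. that `z` is the element of the downset of `y` with `y · z = x`.
In a self-similar `L`-algebra the product of any two elements exists. -/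
def IsProd {X : Type u} [LAlgebra X] (x y z : X) : Prop := y ⊸ z = x ∧ z ≼ y

/-- `z` is the meet `x ∧ y` for the partial order of the `L`-algebra. -/
def IsMeet {X : Type u} [LAlgebra X] (x y z : X) : Prop :=
  z ≼ x ∧ z ≼ y ∧ ∀ w : X, w ≼ x → w ≼ y → w ≼ z

/-- The map `f` identifies `X` with an `L`-subalgebra of the self-similar `L`-algebra `A` which
generates `A` as a monoid. -/
structure IsSelfSimilarClosure {X : Type u} {A : Type v} [LAlgebra X] [LAlgebra A]
    (f : X → A) : Prop where
  isSelfSimilar : IsSelfSimilar A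
  isMorphism : IsMorphism f
  injective : Function.Injective f
  /-- the only submonoid of `A` that contains the image of `f` is `A` itself -/
  generates : ∀ T : Set A, 1 ∈ T → (∀ x, f x ∈ T) →
    (∀ a ∈ T, ∀ b ∈ T, ∀ c, IsProd a b c → c ∈ T) → T = Set.univ

/-- Formal expressions in the elements of `X`, a unit, a multiplication, and an implication. -/
inductive Expr (X : Type u) : Type u
  | of : X → Expr X
  | one : Expr X
  | mul : Expr X → Expr X → Expr X
  | imp : Expr X → Expr X → Expr X

/-- The smallest congruence on expressions that forces the monoid laws, the defining equations
`a · (b a) = b`, `(a b) · c = a · (b · c)`, `(a · b) a = (b · a) b` of self-similar `L`-algebras,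
and compatibility with the operation of `X`. -/
inductive Expr.Rel (X : Type u) [LAlgebra X] : Expr X → Expr X → Prop
  | refl (a) : Expr.Rel X a a
  | symm {a b} : Expr.Rel X a b → Expr.Rel X b a
  | trans {a b c} : Expr.Rel X a b → Expr.Rel X b c → Expr.Rel X a c
  | mul_congr {a a' b b'} : Expr.Rel X a a' → Expr.Rel X b b' →
      Expr.Rel X (.mul a b) (.mul a' b')
  | imp_congr {a a' b b'} : Expr.Rel X a a' → Expr.Rel X b b' →
      Expr.Rel X (.imp a b) (.imp a' b')
  | mul_assoc (a b c) : Expr.Rel X (.mul (.mul a b) c) (.mul a (.mul b c))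
  | one_mul (a) : Expr.Rel X (.mul .one a) a
  | mul_one (a) : Expr.Rel X (.mul a .one) a
  | imp_mul (a b) : Expr.Rel X (.imp a (.mul b a)) b
  | mul_imp (a b c) : Expr.Rel X (.imp (.mul a b) c) (.imp a (.imp b c))
  | imp_mul_comm (a b) : Expr.Rel X (.mul (.imp a b) a) (.mul (.imp b a) b)
  | of_imp (x y : X) : Expr.Rel X (.of (x ⊸ y)) (.imp (.of x) (.of y))

/-- The congruence on expressions as a setoid. -/
def Expr.setoid (X : Type u) [LAlgebra X] : Setoid (Expr X) :=
  ⟨Expr.Rel X, .refl, .symm, .trans⟩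

/-- The self-similar closure `S(X)` of an `L`-algebra `X`: the universal self-similar `L`-algebra
over `X`. -/
def S (X : Type u) [LAlgebra X] : Type u := Quotient (Expr.setoid X)

namespace S

/-- The canonical map `X → S(X)`. -/
def of {X : Type u} [LAlgebra X] (x : X) : S X := Quotient.mk (Expr.setoid X) (.of x)

instance instMonoid {X : Type u} [LAlgebra X] : Monoid (S X) where
  one := Quotient.mk (Expr.setoid X) .one
  mul := Quotient.map₂ Expr.mul fun _ _ h _ _ h' => Expr.Rel.mul_congr h h'
  mul_assoc := by
    rintro ⟨a⟩ ⟨b⟩ ⟨c⟩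
    exact Quotient.sound (Expr.Rel.mul_assoc a b c)
  one_mul := by
    rintro ⟨a⟩
    exact Quotient.sound (Expr.Rel.one_mul a)
  mul_one := by
    rintro ⟨a⟩
    exact Quotient.sound (Expr.Rel.mul_one a)

/-- The operation `a · b` of `S(X)`. -/
def imp {X : Type u} [LAlgebra X] : S X → S X → S X :=
  Quotient.map₂ Expr.imp fun _ _ h _ _ h' => Expr.Rel.imp_congr h h'

theorem imp_mul {X : Type u} [LAlgebra X] (a b : S X) : imp a (b * a) = b := by
  induction a using Quotient.inductionOn
  induction b using Quotient.inductionOn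
  exact Quotient.sound (Expr.Rel.imp_mul _ _)

theorem mul_imp {X : Type u} [LAlgebra X] (a b c : S X) : imp (a * b) c = imp a (imp b c) := by
  induction a using Quotient.inductionOn
  induction b using Quotient.inductionOn
  induction c using Quotient.inductionOn
  exact Quotient.sound (Expr.Rel.mul_imp _ _ _)

theorem imp_mul_comm {X : Type u} [LAlgebra X] (a b : S X) : imp a b * a = imp b a * b := by
  induction a using Quotient.inductionOn
  induction b using Quotient.inductionOn
  exact Quotient.sound (Expr.Rel.imp_mul_comm _ _)

theorem imp_self {X : Type u} [LAlgebra X] (a : S X) : imp a a = 1 := by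
  simpa using imp_mul a 1

theorem one_imp {X : Type u} [LAlgebra X] (a : S X) : imp 1 a = a := by
  simpa using imp_mul 1 a

theorem imp_one {X : Type u} [LAlgebra X] (a : S X) : imp a 1 = 1 := by
  have h := imp_mul_comm a 1
  rw [one_imp, mul_one] at h
  rw [← imp_mul a (imp a 1), h, imp_self]

instance instLAlgebra {X : Type u} [LAlgebra X] : LAlgebra (S X) where
  imp := imp
  imp_self := imp_self
  imp_one := imp_one
  one_imp := one_imp
  imp_imp_imp a b c := by rw [← mul_imp, ← mul_imp, imp_mul_comm]
  imp_antisymm a b h h' := by simpa [h, h'] using imp_mul_comm a b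

theorem isMorphism_of {X : Type u} [LAlgebra X] : IsMorphism (of : X → S X) :=
  fun x y => Quotient.sound (Expr.Rel.of_imp x y)

/-- The multiplication of `S(X)` is the one determined by its `L`-algebra structure. -/
theorem isProd_mul {X : Type u} [LAlgebra X] (a b : S X) : IsProd a b (a * b) :=
  ⟨imp_mul b a, by
    change imp (a * b) b = 1
    rw [mul_imp, imp_self, imp_one]⟩

end S

end LAlgebra

/-! The letters (x,1) and (1,y) act trivially on each other, so the identity (a·b)a = (b·a)b makes
them commute in S(X × Y), with product (x,y). Hence the images of S(X) and S(Y) commute, which gives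
a monoid homomorphism `ofProd` back from S(X) × S(Y). Since S(X × Y) is generated by letters
(`mul_of_induction`), `ofProd` is a left inverse of `toProd`. Surjectivity holds because (a,1)(1,b)
= (a,b), so X × Y generates S(X) × S(Y). Uniqueness follows since multiplication is determined by
implication.

The remaining point is that X embeds in S(X), i.e. that the defining relations do not identify
letters. Expressions are therefore evaluated as words over X: implication extends to words, mutual
implication is a congruence satisfying every relation, and on single letters it is equality. -/

namespace LAlgebra

/-! ### The word model of the self-similar closure

A word is a list of letters whose head is its rightmost letter, so the product `u v` of two words
is the list `v ++ u`. -/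

namespace Word

variable {X : Type u} [LAlgebra X]

/-- The letter `w · x`, for a word `w` and a letter `x`. -/
def act : List X → X → X
  | [], x => x
  | y :: w, x => act w (y ⊸ x)

/-- The word `x · w`, for a letter `x` and a word `w`. -/
def res : X → List X → List X
  | _, [] => []
  | x, y :: w => (x ⊸ y) :: res (y ⊸ x) w

/-- The word `u · v`. -/
def imp : List X → List X → List X
  | [], v => v
  | x :: u, v => imp u (res x v)

/-- A word is trivial if all its letters are equal to the logical unit. -/
def Trivial (w : List X) : Prop := ∀ x ∈ w, x = 1

/-- Two words are equivalent if they imply each other. -/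
def Equiv (u v : List X) : Prop := Trivial (imp u v) ∧ Trivial (imp v u)

theorem imp_nil (u : List X) : imp u [] = [] := by
  induction u with
  | nil => rfl
  | cons x u ih => exact ih

theorem imp_append_left (a b c : List X) : imp (b ++ a) c = imp a (imp b c) := by
  induction b generalizing c with
  | nil => rfl
  | cons x b ih => exact ih _

theorem imp_cons_right (u : List X) (x : X) (v : List X) :
    imp u (x :: v) = act u x :: imp (res x u) v := by
  induction u generalizing x v with
  | nil => rfl
  | cons y u ih => exact ih _ _

theorem res_append (x : X) (c b : List X) : res x (c ++ b) = res x c ++ res (act c x) b := by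
  induction c generalizing x with
  | nil => rfl
  | cons y c ih => exact congrArg _ (ih _)

/-- The word form of a·(bc) = ((c·a)·b)(a·c). -/
theorem imp_append_right (a b c : List X) : imp a (c ++ b) = imp a c ++ imp (imp c a) b := by
  induction a generalizing b c with
  | nil => rw [imp_nil]; rfl
  | cons x a ih =>
    rw [imp_cons_right]
    simp only [imp]
    rw [res_append, ih]

theorem trivial_nil : Trivial ([] : List X) := by
  intro x hx
  cases hx

theorem Trivial.append {u v : List X} (hu : Trivial u) (hv : Trivial v) : Trivial (u ++ v) := by
  intro x hx
  rcases List.mem_append.1 hx with h | h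
  · exact hu x h
  · exact hv x h

theorem res_one (v : List X) : res 1 v = v := by
  induction v with
  | nil => rfl
  | cons y v ih => simp only [res, one_imp, imp_one, ih]

theorem Trivial.imp_left {t : List X} (ht : Trivial t) (v : List X) : imp t v = v := by
  induction t with
  | nil => rfl
  | cons x t ih =>
    rw [imp, ht x List.mem_cons_self, res_one]
    exact ih fun y hy => ht y (List.mem_cons_of_mem _ hy)

theorem Trivial.res {t : List X} (ht : Trivial t) (x : X) : Trivial (res x t) := by
  induction t generalizing x with
  | nil => exact trivial_nil
  | cons y t ih =>
    intro z hz
    rcases List.mem_cons.1 hz with h | h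
    · rw [h, ht y List.mem_cons_self, imp_one]
    · exact ih (fun w hw => ht w (List.mem_cons_of_mem _ hw)) _ z h

theorem Trivial.imp_right {t : List X} (ht : Trivial t) (u : List X) : Trivial (imp u t) := by
  induction u generalizing t with
  | nil => exact ht
  | cons x u ih => exact ih (ht.res x)

theorem trivial_imp_self (u : List X) : Trivial (imp u u) := by
  induction u with
  | nil => exact trivial_nil
  | cons y w ih =>
    have h1 : Trivial [(1 : X)] := by
      intro x hx
      simpa using hx
    have h : imp (y :: w) (y :: w) = imp w ([1] ++ w) := by
      simp only [imp, res, imp_self, res_one, List.cons_append, List.nil_append]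
    rw [h, imp_append_right, h1.imp_left]
    exact (h1.imp_right w).append ih

/-- The axiom of X passes to words in three stages, replacing first the third, then the second, then
the first variable by a word. -/
theorem res_res_res (x y : X) (c : List X) :
    res (x ⊸ y) (res x c) = res (y ⊸ x) (res y c) := by
  induction c generalizing x y with
  | nil => rfl
  | cons z c ih =>
    simp only [res]
    -- The first rewrite matches the heads; the other two bring the tails to the induction
    -- hypothesis for z·x and z·y.
    rw [imp_imp_imp x y z, imp_imp_imp x z y, imp_imp_imp y z x, ih]

theorem imp_res_res (x : X) (b c : List X) :
    imp (res x b) (res x c) = res (act b x) (imp b c) := by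
  induction b generalizing x c with
  | nil => rfl
  | cons y b ih =>
    simp only [res, imp, act]
    rw [res_res_res, ih]

theorem imp_imp_imp (a b c : List X) : imp (imp a b) (imp a c) = imp (imp b a) (imp b c) := by
  induction a generalizing b c with
  | nil => rw [imp_nil]; rfl
  | cons x a ih =>
    rw [imp_cons_right b]
    simp only [imp]
    rw [ih, imp_res_res]

/-! ### Mutual implication is a congruence on words. -/

theorem Equiv.refl (u : List X) : Equiv u u := ⟨trivial_imp_self u, trivial_imp_self u⟩

theorem Equiv.symm {u v : List X} (h : Equiv u v) : Equiv v u := ⟨h.2, h.1⟩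

theorem trivial_imp_trans {u v w : List X} (h : Trivial (imp u v)) (h' : Trivial (imp v w)) :
    Trivial (imp u w) := by
  -- As u·v is trivial, u·w = (u·v)·(u·w) = (v·u)·(v·w).
  rw [← h.imp_left (imp u w), imp_imp_imp]
  exact h'.imp_right _

theorem Equiv.trans {u v w : List X} (h : Equiv u v) (h' : Equiv v w) : Equiv u w :=
  ⟨trivial_imp_trans h.1 h'.1, trivial_imp_trans h'.2 h.2⟩

theorem Equiv.imp_left_eq {a a' : List X} (h : Equiv a a') (c : List X) : imp a c = imp a' c := by
  rw [← h.1.imp_left (imp a c), imp_imp_imp, h.2.imp_left]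

theorem trivial_imp_imp {c c' : List X} (h : Trivial (imp c c')) (a : List X) :
    Trivial (imp (imp a c) (imp a c')) := by
  rw [imp_imp_imp]
  exact h.imp_right _

theorem Equiv.imp_congr {a a' c c' : List X} (h : Equiv a a') (h' : Equiv c c') :
    Equiv (imp a c) (imp a' c') := by
  rw [h.imp_left_eq]
  exact ⟨trivial_imp_imp h'.1 _, trivial_imp_imp h'.2 _⟩

theorem trivial_imp_append {a a' b b' : List X} (ha : Trivial (imp a a')) (hb : Equiv b b') :
    Trivial (imp (b ++ a) (b' ++ a')) := by
  rw [imp_append_left, imp_append_right, hb.2.imp_left, imp_append_right, hb.1.imp_left]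
  exact (hb.1.imp_right a).append ha

theorem Equiv.append {a a' b b' : List X} (ha : Equiv a a') (hb : Equiv b b') :
    Equiv (b ++ a) (b' ++ a') :=
  ⟨trivial_imp_append ha.1 hb, trivial_imp_append ha.2 hb.symm⟩

theorem Trivial.equiv_append {t : List X} (ht : Trivial t) (b : List X) : Equiv (t ++ b) b := by
  constructor
  · rw [imp_append_left, ht.imp_left]
    exact trivial_imp_self b
  · rw [imp_append_right, ht.imp_left]
    exact (ht.imp_right b).append (trivial_imp_self b)

theorem equiv_imp_append (a b : List X) : Equiv (imp a (a ++ b)) b := by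
  rw [imp_append_right, (trivial_imp_self a).imp_left]
  exact (trivial_imp_self a).equiv_append b

theorem trivial_imp_append_imp (a b : List X) : Trivial (imp (a ++ imp a b) (b ++ imp b a)) := by
  rw [imp_append_left, imp_append_right a, imp_append_right (imp a b)]
  exact (trivial_imp_self _).append ((trivial_imp_self _).imp_right _)

theorem equiv_append_imp (a b : List X) : Equiv (a ++ imp a b) (b ++ imp b a) :=
  ⟨trivial_imp_append_imp a b, trivial_imp_append_imp b a⟩

theorem Equiv.eq_of_singleton {x y : X} (h : Equiv [x] [y]) : x = y :=
  imp_antisymm x y (h.1 _ List.mem_cons_self) (h.2 _ List.mem_cons_self)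

/-- The word denoted by a formal expression. -/
def ofExpr : Expr X → List X
  | .of x => [x]
  | .one => []
  | .mul a b => ofExpr b ++ ofExpr a
  | .imp a b => imp (ofExpr a) (ofExpr b)

theorem equiv_ofExpr {a b : Expr X} (h : Expr.Rel X a b) : Equiv (ofExpr a) (ofExpr b) := by
  induction h with
  | refl a => exact .refl _
  | symm _ ih => exact ih.symm
  | trans _ _ ih ih' => exact ih.trans ih'
  | mul_congr _ _ ih ih' => exact ih.append ih'
  | imp_congr _ _ ih ih' => exact ih.imp_congr ih'
  | mul_assoc a b c => simpa only [ofExpr, List.append_assoc] using Equiv.refl _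
  | one_mul a => simpa only [ofExpr, List.append_nil] using Equiv.refl _
  | mul_one a => exact .refl _
  | imp_mul a b => exact equiv_imp_append _ _
  | mul_imp a b c => simpa only [ofExpr, imp_append_left] using Equiv.refl _
  | imp_mul_comm a b => exact equiv_append_imp _ _
  | of_imp x y => exact .refl _

end Word

/-! ### Self-similar closures -/

namespace S

variable {X : Type u} {Y : Type v} [LAlgebra X] [LAlgebra Y]

theorem of_injective : Function.Injective (of : X → S X) := fun _ _ h =>
  (Word.equiv_ofExpr (Quotient.exact h)).eq_of_singleton

theorem of_one : of (1 : X) = 1 := by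
  rw [← LAlgebra.imp_self (1 : X), isMorphism_of, LAlgebra.imp_self]

theorem imp_mul_cancel (a b : S X) : a ⊸ b * a = b := imp_mul a b

theorem mul_imp_eq (a b c : S X) : a * b ⊸ c = a ⊸ b ⊸ c := mul_imp a b c

theorem imp_mul_swap (a b : S X) : (a ⊸ b) * a = (b ⊸ a) * b := imp_mul_comm a b

theorem mul_right_cancel {a b c : S X} (h : a * c = b * c) : a = b := by
  rw [← imp_mul_cancel c a, h, imp_mul_cancel]

/-- Multiplied by a on the right, both sides become (b·(c·a))bc. The formula turns implications
between words into words, so the letters alone generate S(X) as a monoid. -/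
theorem imp_mul_eq (a b c : S X) : a ⊸ b * c = ((c ⊸ a) ⊸ b) * (a ⊸ c) := by
  apply mul_right_cancel (c := a)
  rw [imp_mul_swap, mul_imp_eq, ← mul_assoc, imp_mul_swap b, mul_assoc, mul_assoc, imp_mul_swap a]

/-- Since c·b = 1, c = (c·b)c = (b·c)b = ab. -/
theorem IsProd.eq_mul {a b c : S X} (h : IsProd a b c) : c = a * b := by
  have hc : c ⊸ b = 1 := h.2
  rw [← h.1, imp_mul_swap, hc, one_mul]

theorem isSelfSimilar : IsSelfSimilar (S X) := by
  refine fun y => ⟨fun _ _ => Set.mem_univ _, fun a ha b hb hab => ?_, fun x _ => ?_⟩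
  · rw [IsProd.eq_mul ⟨rfl, ha⟩, IsProd.eq_mul ⟨rfl, hb⟩]
    exact congrArg (· * y) hab
  · exact ⟨x * y, (isProd_mul x y).2, imp_mul_cancel y x⟩

/-- The element of `S(X)` represented by a word. -/
def ofWord : List X → S X
  | [] => 1
  | x :: w => ofWord w * of x

theorem ofWord_append (u v : List X) : ofWord (v ++ u) = ofWord u * ofWord v := by
  induction v with
  | nil => exact (mul_one _).symm
  | cons x v ih => simp only [List.cons_append, ofWord, ih, mul_assoc]

theorem ofWord_res (x : X) (w : List X) : ofWord (Word.res x w) = of x ⊸ ofWord w := by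
  induction w generalizing x with
  | nil => exact (LAlgebra.imp_one _).symm
  | cons y w ih =>
    simp only [Word.res, ofWord]
    rw [ih, imp_mul_eq, isMorphism_of, isMorphism_of]

theorem ofWord_imp (u v : List X) : ofWord (Word.imp u v) = ofWord u ⊸ ofWord v := by
  induction u generalizing v with
  | nil => exact (LAlgebra.one_imp _).symm
  | cons x u ih =>
    simp only [Word.imp, ofWord]
    rw [ih, ofWord_res, mul_imp_eq]

theorem ofWord_ofExpr (e : Expr X) : ofWord (Word.ofExpr e) = Quotient.mk (Expr.setoid X) e := by
  induction e with
  | of x => exact one_mul _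
  | one => rfl
  | mul a b iha ihb =>
    rw [Word.ofExpr, ofWord_append, iha, ihb]
    rfl
  | imp a b iha ihb =>
    rw [Word.ofExpr, ofWord_imp, iha, ihb]
    rfl

/-- `S(X)` is generated by `X` as a monoid. -/
theorem mul_of_induction {P : S X → Prop} (one : P 1) (mul_of : ∀ a x, P a → P (a * of x))
    (a : S X) : P a := by
  induction a using Quotient.inductionOn with
  | h e =>
    rw [← ofWord_ofExpr]
    generalize Word.ofExpr e = w
    induction w with
    | nil => exact one
    | cons x w ih => exact mul_of _ x ih

/-- The value in `S(Y)` of a formal expression in the elements of `X`. -/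
def exprValue (f : X → S Y) : Expr X → S Y
  | .of x => f x
  | .one => 1
  | .mul a b => exprValue f a * exprValue f b
  | .imp a b => exprValue f a ⊸ exprValue f b

theorem exprValue_eq {f : X → S Y} (hf : IsMorphism f) {a b : Expr X} (h : Expr.Rel X a b) :
    exprValue f a = exprValue f b := by
  induction h with
  | refl a => rfl
  | symm _ ih => exact ih.symm
  | trans _ _ ih ih' => exact ih.trans ih'
  | mul_congr _ _ ih ih' => exact congrArg₂ (· * ·) ih ih'
  | imp_congr _ _ ih ih' => exact congrArg₂ (· ⊸ ·) ih ih'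
  | mul_assoc a b c => exact _root_.mul_assoc _ _ _
  | one_mul a => exact _root_.one_mul _
  | mul_one a => exact _root_.mul_one _
  | imp_mul a b => exact imp_mul_cancel _ _
  | mul_imp a b c => exact mul_imp_eq _ _ _
  | imp_mul_comm a b => exact imp_mul_swap _ _
  | of_imp x y => exact hf x y

/-- The monoid homomorphism `S(X) → S(Y)` induced by a morphism `X → Y`. -/
def map (f : X → Y) (hf : IsMorphism f) : S X →* S Y where
  toFun := Quotient.lift (exprValue fun x => of (f x)) fun _ _ =>
    exprValue_eq fun x y => by rw [hf, isMorphism_of]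
  map_one' := rfl
  map_mul' := by
    rintro ⟨a⟩ ⟨b⟩
    rfl

theorem map_of (f : X → Y) (hf : IsMorphism f) (x : X) : map f hf (of x) = of (f x) := rfl

theorem map_imp (f : X → Y) (hf : IsMorphism f) (a b : S X) :
    map f hf (a ⊸ b) = map f hf a ⊸ map f hf b := by
  induction a using Quotient.inductionOn
  induction b using Quotient.inductionOn
  rfl

/-! ### The product of two self-similar closures -/

theorem isProd_prod {a b c : S X × S Y} : IsProd a b c ↔ c = a * b := by
  constructor
  · intro h
    exact Prod.ext (IsProd.eq_mul ⟨congrArg Prod.fst h.1, congrArg Prod.fst h.2⟩)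
      (IsProd.eq_mul ⟨congrArg Prod.snd h.1, congrArg Prod.snd h.2⟩)
  · rintro rfl
    exact ⟨Prod.ext (isProd_mul _ _).1 (isProd_mul _ _).1,
      Prod.ext (isProd_mul _ _).2 (isProd_mul _ _).2⟩

theorem isSelfSimilar_prod : IsSelfSimilar (S X × S Y) := by
  refine fun y => ⟨fun _ _ => Set.mem_univ _, fun a ha b hb hab => ?_, fun x _ => ?_⟩
  · rw [isProd_prod.1 ⟨rfl, ha⟩, isProd_prod.1 ⟨rfl, hb⟩]
    exact congrArg (· * y) hab
  · exact ⟨x * y, (isProd_prod.2 rfl).2, (isProd_prod.2 rfl).1⟩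

theorem isSelfSimilarClosure_prod :
    IsSelfSimilarClosure (fun p : X × Y => ((of p.1, of p.2) : S X × S Y)) where
  isSelfSimilar := isSelfSimilar_prod
  isMorphism p q := Prod.ext (isMorphism_of p.1 q.1) (isMorphism_of p.2 q.2)
  injective p q h :=
    Prod.ext (of_injective (congrArg Prod.fst h)) (of_injective (congrArg Prod.snd h))
  generates T h1 hof hmul := by
    have hmul' : ∀ a ∈ T, ∀ b ∈ T, a * b ∈ T := fun a ha b hb =>
      hmul a ha b hb _ (isProd_prod.2 rfl)
    have hfst : ∀ a : S X, (a, (1 : S Y)) ∈ T := by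
      refine mul_of_induction h1 fun a x ha => ?_
      simpa [of_one] using hmul' _ ha _ (hof (x, 1))
    have hsnd : ∀ b : S Y, ((1 : S X), b) ∈ T := by
      refine mul_of_induction h1 fun b y hb => ?_
      simpa [of_one] using hmul' _ hb _ (hof (1, y))
    refine Set.eq_univ_of_forall fun p => ?_
    simpa using hmul' _ (hfst p.1) _ (hsnd p.2)

/-! ### Products of letters from the two factors. -/

theorem inr_mul_inl (x : X) (y : Y) : of ((1 : X), y) * of (x, (1 : Y)) = of (x, y) := by
  have h := imp_mul_swap (of (x, (1 : Y))) (of (x, y))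
  rw [← isMorphism_of, ← isMorphism_of] at h
  have h1 : (x, (1 : Y)) ⊸ (x, y) = (1, y) :=
    Prod.ext (LAlgebra.imp_self x) (LAlgebra.one_imp y)
  have h2 : (x, y) ⊸ (x, (1 : Y)) = 1 :=
    Prod.ext (LAlgebra.imp_self x) (LAlgebra.imp_one y)
  rwa [h1, h2, of_one, one_mul] at h

theorem inr_imp_inl (x : X) (y : Y) : of ((1 : X), y) ⊸ of (x, (1 : Y)) = of (x, 1) := by
  rw [← isMorphism_of]
  exact congrArg of (Prod.ext (LAlgebra.one_imp x) (LAlgebra.imp_one y))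

theorem inl_imp_inr (x : X) (y : Y) : of (x, (1 : Y)) ⊸ of ((1 : X), y) = of (1, y) := by
  rw [← isMorphism_of]
  exact congrArg of (Prod.ext (LAlgebra.imp_one x) (LAlgebra.one_imp y))

theorem inl_mul_inr (x : X) (y : Y) : of (x, (1 : Y)) * of ((1 : X), y) = of (x, y) := by
  have h := imp_mul_swap (of (x, (1 : Y))) (of ((1 : X), y))
  rw [inl_imp_inr, inr_imp_inl] at h
  rw [← h, inr_mul_inl]

/-- The product of `a` and `b` is their meet if `a · b = b` and `b · a = a`. -/
theorem isMeet_mul {a b : S X} (hab : a ⊸ b = b) (hba : b ⊸ a = a) : IsMeet a b (a * b) := by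
  have hcomm : b * a = a * b := by
    have h := imp_mul_swap a b
    rwa [hab, hba] at h
  refine ⟨?_, (isProd_mul a b).2, fun w (hwa : w ⊸ a = 1) (hwb : w ⊸ b = 1) => ?_⟩
  · rw [← hcomm]
    exact (isProd_mul b a).2
  · change w ⊸ a * b = 1
    rw [imp_mul_eq, hwb, mul_one]
    -- With a = b·a, the goal's left side is (b·w)·(b·a) = (w·b)·(w·a), and both w·b and w·a are 1.
    nth_rw 1 [← hba]
    rw [LAlgebra.imp_imp_imp, hwb, hwa, LAlgebra.imp_one]

theorem isMorphism_inl : IsMorphism fun x : X => (x, (1 : Y)) :=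
  fun _ _ => Prod.ext rfl (LAlgebra.imp_self _).symm

theorem isMorphism_inr : IsMorphism fun y : Y => ((1 : X), y) :=
  fun _ _ => Prod.ext (LAlgebra.imp_self _).symm rfl

theorem isMorphism_fst : IsMorphism (Prod.fst : X × Y → X) := fun _ _ => rfl

theorem isMorphism_snd : IsMorphism (Prod.snd : X × Y → Y) := fun _ _ => rfl

/-- The canonical map `S(X × Y) → S(X) × S(Y)`. -/
def toProd : S (X × Y) →* S X × S Y :=
  (map Prod.fst isMorphism_fst).prod (map Prod.snd isMorphism_snd)

theorem toProd_of (p : X × Y) : toProd (of p) = (of p.1, of p.2) := rfl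

theorem isMorphism_toProd : IsMorphism (toProd : S (X × Y) → S X × S Y) :=
  fun a b => Prod.ext (map_imp _ _ a b) (map_imp _ _ a b)

/-- Induction on generators in both arguments reduces this to single letters. -/
theorem commute_map_inl_map_inr (a : S X) (b : S Y) :
    Commute (map _ (isMorphism_inl (Y := Y)) a) (map _ (isMorphism_inr (X := X)) b) := by
  induction a using mul_of_induction with
  | one => simp
  | mul_of a x ha =>
    rw [map_mul]
    refine ha.mul_left ?_
    clear ha
    induction b using mul_of_induction with
    | one => simp
    | mul_of b y hb =>
      rw [map_mul]
      refine hb.mul_right ?_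
      exact (inl_mul_inr x y).trans (inr_mul_inl x y).symm

/-- The monoid homomorphism `S(X) × S(Y) → S(X × Y)` induced by the inclusions of the factors. -/
def ofProd : S X × S Y →* S (X × Y) :=
  (map _ isMorphism_inl).noncommCoprod (map _ isMorphism_inr) commute_map_inl_map_inr

theorem ofProd_of (p : X × Y) : ofProd (of p.1, of p.2) = of p := inl_mul_inr p.1 p.2

theorem ofProd_toProd (z : S (X × Y)) : ofProd (toProd z) = z := by
  induction z using mul_of_induction with
  | one => rw [map_one, map_one]
  | mul_of z p hz => rw [map_mul, map_mul, hz, toProd_of, ofProd_of]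

theorem range_toProd : Set.range (toProd : S (X × Y) → S X × S Y) = Set.univ := by
  refine isSelfSimilarClosure_prod.generates _ ⟨1, map_one _⟩ (fun p => ⟨of p, toProd_of p⟩) ?_
  rintro _ ⟨a, rfl⟩ _ ⟨b, rfl⟩ c hc
  exact ⟨a * b, by rw [map_mul, isProd_prod.1 hc]⟩

theorem bijective_toProd : Function.Bijective (toProd : S (X × Y) → S X × S Y) :=
  ⟨Function.LeftInverse.injective ofProd_toProd, Set.range_eq_univ.1 range_toProd⟩

/-- A morphism of `L`-algebras that extends the inclusion of `X × Y` is the canonical map. -/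
theorem eq_toProd {e : S (X × Y) → S X × S Y} (he : IsMorphism e)
    (hof : ∀ p, e (of p) = (of p.1, of p.2)) : e = toProd := by
  have h1 : e 1 = 1 := by
    rw [← LAlgebra.imp_self 1, he, LAlgebra.imp_self]
  have hmul : ∀ a b, e (a * b) = e a * e b := fun a b => by
    have h2 : a * b ⊸ b = 1 := (isProd_mul a b).2
    -- Being a product is expressed by implication alone, so `e` preserves it.
    refine isProd_prod.1 ⟨?_, ?_⟩
    · rw [← he, imp_mul_cancel]
    · change e (a * b) ⊸ e b = 1
      rw [← he, h2, h1]
  funext z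
  induction z using mul_of_induction with
  | one => rw [h1, map_one]
  | mul_of z p hz => rw [hmul, map_mul, hz, hof, toProd_of]

end S

end LAlgebra

open LAlgebra in
theorem proposition5 {X : Type u} {Y : Type v} [LAlgebra X] [LAlgebra Y] :
    -- `S(X) × S(Y)` is a self-similar closure of `X × Y` ...
    IsSelfSimilarClosure (fun p : X × Y => ((S.of p.1, S.of p.2) : S X × S Y)) ∧
    -- ... and the canonical morphism `S(X × Y) → S(X) × S(Y)` is an isomorphism.
    (∃ e : S (X × Y) → S X × S Y,
      (IsMorphism e ∧ ∀ p : X × Y, e (S.of p) = (S.of p.1, S.of p.2)) ∧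
      (∀ e' : S (X × Y) → S X × S Y,
        (IsMorphism e' ∧ ∀ p : X × Y, e' (S.of p) = (S.of p.1, S.of p.2)) → e' = e) ∧
      Function.Bijective e) ∧
    -- In `S(X × Y)`, where `x` and `y` stand for `(x, 1)` and `(1, y)`: `x y = y x = x ∧ y`, and
    -- this element is `(x, y)`.
    (∀ (x : X) (y : Y),
      S.of (x, (1 : Y)) * S.of ((1 : X), y) = S.of (x, y) ∧
      S.of ((1 : X), y) * S.of (x, (1 : Y)) = S.of (x, y) ∧
      IsMeet (S.of (x, (1 : Y))) (S.of ((1 : X), y)) (S.of (x, y))) ∧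
    -- Each element of `X × Y` has a unique representation of this form.
    (∀ z : X × Y, ∃! p : X × Y, S.of (p.1, (1 : Y)) * S.of ((1 : X), p.2) = S.of z) := by
  refine ⟨S.isSelfSimilarClosure_prod,
    ⟨S.toProd, ⟨S.isMorphism_toProd, S.toProd_of⟩, fun e he => S.eq_toProd he.1 he.2,
      S.bijective_toProd⟩,
    fun x y => ⟨S.inl_mul_inr x y, S.inr_mul_inl x y, ?_⟩, fun z => ⟨z, S.inl_mul_inr z.1 z.2, ?_⟩⟩
  · have h := S.isMeet_mul (S.inl_imp_inr x y) (S.inr_imp_inl x y)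
    rwa [S.inl_mul_inr] at h
  · intro p hp
    exact S.of_injective ((S.inl_mul_inr p.1 p.2).symm.trans hp)
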